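/- Let $\mathfrak W=(W,+,0)$ be a commutative monoid, $A$ a set of labels, $\Sigma$ (process signature) and $\Theta$ (weight signature) finitary algebraic signatures. $T^S X$ denotes the set of $S$-terms over variables $X$, and $\mathcal F_{\mathfrak W}X$ the set of finitely supported functions $\rho:X\to W$; for $f:X\to Y$ put $\rho[f](y)=\sum_{x\in f^{-1}(y)}\rho(x)$; for $C\subseteq X$ put $\rho(C)=\sum_{x\in C}\rho(x)$, and $\lfloor\rho\rfloor=\rho(X)$. **ULTraSs.** A ULTraS on $X$ is a relation $\to\ \subseteq X\times A\times\mathcal F_{\mathfrak W}X$, written $x\xrightarrow{a}\rho$; it is image-finite if $\{\rho\mid x\xrightarrow{a}\rho\}$ is finite for all $x,a$. A homomorphism $f:X\to Y$ of ULTraSs is a map with $\{\psi\mid f(x)\xrightarrow{a}\psi\}=\{\rho[f]\mid x\xrightarrow{a}\rho\}$ for all $x,a$. States $x,y$ of a ULTraS are behaviourally equivalent if $f(x)=f(y)$ for some homomorphism $f$ from it to a ULTraS. A relation $R\subseteq X\times Y$ between the states of two ULTraSs is a bisimulation if, whenever $x\,R\,y$ and $a\in A$, each $x\xrightarrow{a}\phi$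 is matched by some $y\xrightarrow{a}\psi$, and each $y\xrightarrow{a}\psi$ by some $x\xrightarrow{a}\phi$, such that $\phi(C)=\psi(D)$ for all $C\subseteq X$, $D\subseteq Y$ for which $x\,R\,y$ implies ($x\in C\iff y\in D$). States of one ULTraS are bisimilar if some bisimulation from it to itself relates them. **Rules.** A club is a subset $\mathfrak C\subseteq W$ with $\mathfrak C+W\subseteq\mathfrak C$ whose complement is a submonoid. A WF-GSOS rule consists of an $n$-ary $\mathtt f\in\Sigma$, sets $A_i,B_i\subseteq A$ with $A_i\cap B_i=\emptyset$ ($1\le i\le n$), numbers $m_i^a\in\mathbb N$ ($a\in A_i$), and $$\frac{\{x_i\xrightarrow{a}\phi^a_{ij}\}_{i\le n,\,a\in A_i,\,1\le j\le m_i^a}\quad\{x_i\not\xrightarrow{b}\}_{i\le n,\,b\in B_i}\quad\{\lfloor\phi^{a_k}_{i_kj_k}\rfloor=w_k\}_{1\le k\le p}\quad\{\phi^{a'_k}_{i'_kj'_k}(y_k)\in\mathfrak C_k\}_{1\le k\le q}}{\mathtt f(x_1,\dots,x_n)\xrightarrow{c}\psi}$$ with pairwise distinct variables $x_i,y_k$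 and $\phi^a_{ij}$, $w_k\in W$, clubs $\mathfrak C_k$, $c\in A$ and $\psi$ a $\Theta$-term over the $x_i$, $y_k$, $\phi^a_{ij}$. Its trigger is $\langle A_1,\dots,A_n\rangle,\langle w_1,\dots,w_p\rangle$. **Specifications.** A WF-GSOS specification is a set $\mathcal R$ of such rules, only finitely many of which share the same $\mathtt f$, $c$ and trigger, with an interpretation: maps $\{|{-}|\}_X:T^\Theta(X+\mathcal F_{\mathfrak W}X)\to\mathcal P_f\,\mathcal F_{\mathfrak W}T^\Sigma X$ for all sets $X$ such that $\{\rho[T^\Sigma\sigma]\mid\rho\in\{|\psi|\}_X\}=\{|\psi[\sigma]|\}_Y$ for all $\sigma:X\to Y$ and $\psi$, where $\psi[\sigma]$ is the renaming of $\psi$ along $\sigma+\mathcal F_{\mathfrak W}\sigma$. **Induced ULTraS.** On the set $T=T^\Sigma\emptyset$ of ground terms it is defined by structural recursion: $\mathtt f(p_1,\dots,p_n)\xrightarrow{c}\rho$ iff there are a rule of $\mathcal R$ as above for $\mathtt f$ and $c$ such that $p_i$ has an $a$-transition for every $a\in A_i$ and no $b$-transition for every $b\in B_i$, and assignments $\theta(\phi^a_{ij})\in\mathcal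 F_{\mathfrak W}T$, $\sigma(x_i)=p_i$, $\sigma(y_k)\in T$ with $p_i\xrightarrow{a}\theta(\phi^a_{ij})$, $\lfloor\theta(\phi^{a_k}_{i_kj_k})\rfloor=w_k$ and $\theta(\phi^{a'_k}_{i'_kj'_k})(\sigma(y_k))\in\mathfrak C_k$, such that $\rho=\rho'[a^\sharp]$ for some $\rho'\in\{|\psi[\sigma,\theta]|\}_T$, where $a^\sharp:T^\Sigma T\to T$ evaluates terms over ground terms. **Theorem (Congruence).** For every WF-GSOS specification, bisimilarity on the induced ULTraS over ground process terms is a congruence with respect to $\Sigma$: it is an equivalence relation, and if $p_i$ and $q_i$ are bisimilar for $1\le i\le n$, then so are $\mathtt f(p_1,\dots,p_n)$ and $\mathtt f(q_1,\dots,q_n)$, for every $n$-ary $\mathtt f\in\Sigma$. Moreover bisimilarity coincides with behavioural equivalence on the induced ULTraS; if the latter is image-finite, it also coincides with behavioural equivalence in the category of $(\mathcal P_f\mathcal F_{\mathfrak W})^A$-coalgebras, i.e. of image-finite ULTraSs. -/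

import Mathlib

universe u u' t t' v w

namespace WFGSOS

/-! ### ULTraSs and their bisimulations

Finitely supported weight functions on `X` are `X →₀ W`; the action `ρ[f]` of a map `f` on a
weight function `ρ` is `Finsupp.mapDomain f ρ`. -/

/-- A `W`-weighted uniform labelled transition system with states `X`, labels `A` and finitely
supported weight functions: `ρ ∈ α x a` means that there is a transition from `x` to `ρ`
labelled `a`. -/
abbrev ULTraS (W : Type w) [AddCommMonoid W] (A : Type v) (X : Type u) :=
  X → A → Set (X →₀ W)

/-- For every state and label there are finitely many transitions. -/
def ULTraS.ImageFinite {W : Type w} [AddCommMonoid W] {A : Type v} {X : Type u}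
    (α : ULTraS W A X) : Prop :=
  ∀ x a, (α x a).Finite

/-- The total weight `∑ x, ρ x` of a finitely supported weight function. -/
def totalWeight {W : Type w} [AddCommMonoid W] {X : Type u} (ρ : X →₀ W) : W :=
  ρ.sum fun _ r => r

open Classical in
/-- The weight assigned to a set `C`: the total weight of the restriction of `ρ` to `C`. -/
noncomputable def weightOn {W : Type w} [AddCommMonoid W] {X : Type u}
    (ρ : X →₀ W) (C : Set X) : W :=
  totalWeight (ρ.filter (· ∈ C))

/-- The subset closure of a relation `R`. -/
def SubsetClosure {X : Type u} {Y : Type u'} (R : X → Y → Prop) (C : Set X) (D : Set Y) : Prop :=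
  (∀ x ∈ C, ∀ y, R x y → y ∈ D) ∧ (∀ y ∈ D, ∀ x, R x y → x ∈ C)

/-- The lifting of a relation `R` between states to weight functions. -/
def LiftRel {W : Type w} [AddCommMonoid W] {X : Type u} {Y : Type u'} (R : X → Y → Prop)
    (φ : X →₀ W) (ψ : Y →₀ W) : Prop :=
  ∀ C D, SubsetClosure R C D → weightOn φ C = weightOn ψ D

/-- Bisimulations between two ULTraSs. -/
def IsBisimulation {W : Type w} [AddCommMonoid W] {A : Type v} {X : Type u} {Y : Type u'}
    (α : ULTraS W A X) (β : ULTraS W A Y) (R : X → Y → Prop) : Prop :=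
  ∀ x y, R x y → ∀ a,
    (∀ φ ∈ α x a, ∃ ψ ∈ β y a, LiftRel R φ ψ) ∧
    (∀ ψ ∈ β y a, ∃ φ ∈ α x a, LiftRel R φ ψ)

/-- Two states of a ULTraS are bisimilar if some bisimulation relates them. -/
def Bisimilar {W : Type w} [AddCommMonoid W] {A : Type v} {X : Type u}
    (α : ULTraS W A X) (x y : X) : Prop :=
  ∃ R : X → X → Prop, IsBisimulation α α R ∧ R x y

/-- ULTraS homomorphisms, i.e. morphisms of the corresponding coalgebras: the transitions of
`f x` are exactly the images of the transitions of `x`. -/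
def IsHom {W : Type w} [AddCommMonoid W] {A : Type v} {X : Type u} {Y : Type u'}
    (α : ULTraS W A X) (β : ULTraS W A Y) (f : X → Y) : Prop :=
  ∀ x a, β (f x) a = Finsupp.mapDomain f '' α x a

/-- Behavioural equivalence: two states are equated by some homomorphism out of `α`. -/
def BehEquiv {W : Type w} [AddCommMonoid W] {A : Type v} {X : Type u}
    (α : ULTraS W A X) (x y : X) : Prop :=
  ∃ (Y : Type u) (β : ULTraS W A Y) (f : X → Y), IsHom α β f ∧ f x = f y

/-- Behavioural equivalence for coalgebras of the functor whose values are finite sets of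
finitely supported weight functions: as `BehEquiv`, but through an image-finite ULTraS. -/
def FinBehEquiv {W : Type w} [AddCommMonoid W] {A : Type v} {X : Type u}
    (α : ULTraS W A X) (x y : X) : Prop :=
  ∃ (Y : Type u) (β : ULTraS W A Y) (f : X → Y), β.ImageFinite ∧ IsHom α β f ∧ f x = f y

/-! ### Signatures and terms

A signature is (the functional part of) a `FirstOrder.Language`; terms over variables `X` are
`S.Term X`, ground terms are `S.Term Empty`, substitution of variables for variables is
`FirstOrder.Language.Term.relabel`. Relation symbols play no role. -/

/-- Ground terms. -/
abbrev Ground (S : FirstOrder.Language.{u, u'}) : Type u := S.Term Empty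

/-- Evaluation of terms whose variables are ground terms. -/
def flatten {S : FirstOrder.Language.{u, u'}} (p : S.Term (Ground S)) : Ground S :=
  p.subst id

/-- A congruence on ground terms: an equivalence relation preserved by all operators. -/
structure IsCongruence (S : FirstOrder.Language.{u, u'}) (r : Ground S → Ground S → Prop) :
    Prop where
  equivalence : Equivalence r
  func : ∀ {n : ℕ} (f : S.Functions n) (p q : Fin n → Ground S),
    (∀ i, r (p i) (q i)) →
      r (FirstOrder.Language.Term.func f p) (FirstOrder.Language.Term.func f q)

/-! ### WF-GSOS specifications -/

/-- Clubs of a commutative monoid: ideals whose complement is a submonoid. -/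
structure IsClub {W : Type w} [AddCommMonoid W] (C : Set W) : Prop where
  ideal : ∀ x ∈ C, ∀ y, x + y ∈ C
  zero_compl : (0 : W) ∈ Cᶜ
  add_compl : ∀ x ∈ Cᶜ, ∀ y ∈ Cᶜ, x + y ∈ Cᶜ

/-- A WF-GSOS rule with source `f(x₁, …, xₙ)`. The process variables are `xᵢ` for `i : Fin n`
and `yₖ` for `k : Fin q`; the weight function variables `φᵃᵢⱼ` are indexed by the triples
`⟨i, a, j⟩` with `a ∈ pos i` and `j : Fin (mult i a)`, so that distinct variables have distinct
names. -/
structure Rule (W : Type w) [AddCommMonoid W] (A : Type v) {Sig : FirstOrder.Language.{u, u'}}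
    (Theta : FirstOrder.Language.{t, t'}) {n : ℕ} (f : Sig.Functions n) where
  /-- The labels `a ∈ Aᵢ` of the positive premises on `xᵢ`. -/
  pos : Fin n → Set A
  /-- The labels `b ∈ Bᵢ` of the negative premises on `xᵢ`. -/
  neg : Fin n → Set A
  disjoint : ∀ i, Disjoint (pos i) (neg i)
  /-- The number of premises on `xᵢ` with label `a`. -/
  mult : (i : Fin n) → pos i → ℕ
  /-- The number of total weight premises. -/
  p : ℕ
  /-- The variable in the `k`-th total weight premise. -/
  wtVar : Fin p → (i : Fin n) × (a : pos i) × Fin (mult i a)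
  /-- The constant in the `k`-th total weight premise. -/
  wt : Fin p → W
  /-- The number of selection premises. -/
  q : ℕ
  /-- The weight function variable in the `k`-th selection premise. -/
  selVar : Fin q → (i : Fin n) × (a : pos i) × Fin (mult i a)
  /-- The club in the `k`-th selection premise, which binds `yₖ`. -/
  club : Fin q → Set W
  isClub : ∀ k, IsClub (club k)
  /-- The label of the conclusion. -/
  label : A
  /-- The target of the conclusion, a weight term. -/
  target : Theta.Term (Fin n ⊕ Fin q ⊕ ((i : Fin n) × (a : pos i) × Fin (mult i a)))

/-- The weight function variables of a rule. -/
abbrev Rule.FunVar {W : Type w} [AddCommMonoid W] {A : Type v}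
    {Sig : FirstOrder.Language.{u, u'}} {Theta : FirstOrder.Language.{t, t'}} {n : ℕ}
    {f : Sig.Functions n} (R : Rule W A Theta f) : Type v :=
  (i : Fin n) × (a : R.pos i) × Fin (R.mult i a)

/-- The instances of the target of the rule `R` which `R` derives for the source
`f(x₁, …, xₙ)`, when `h i` is the set of labelled transitions of `xᵢ`. -/
def Rule.Instances {W : Type w} [AddCommMonoid W] {A : Type v}
    {Sig : FirstOrder.Language.{u, u'}} {Theta : FirstOrder.Language.{t, t'}} {n : ℕ}
    {f : Sig.Functions n} (R : Rule W A Theta f) {X : Type u}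
    (x : Fin n → X) (h : Fin n → A → Set (X →₀ W)) : Set (Theta.Term (X ⊕ (X →₀ W))) :=
  {ψ | (∀ i, ∀ a ∈ R.pos i, (h i a).Nonempty) ∧
    (∀ i, ∀ b ∈ R.neg i, h i b = ∅) ∧
    ∃ (θ : R.FunVar → (X →₀ W)) (y : Fin R.q → X),
      (∀ φ : R.FunVar, θ φ ∈ h φ.1 φ.2.1) ∧
      (∀ k, totalWeight (θ (R.wtVar k)) = R.wt k) ∧
      (∀ k, θ (R.selVar k) (y k) ∈ R.club k) ∧
      ψ = R.target.relabel
        (Sum.elim (fun i => Sum.inl (x i)) (Sum.elim (fun k => Sum.inl (y k))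
          (fun φ => Sum.inr (θ φ))))}

/-- Weight term interpretations: families of maps from weight terms over `X` and the finitely
supported weight functions on `X` to finite sets of weight functions on process terms over `X`,
respecting substitutions. -/
structure Interpretation (W : Type w) [AddCommMonoid W] (Sig : FirstOrder.Language.{u, u'})
    (Theta : FirstOrder.Language.{t, t'}) where
  interp : (X : Type u) → Theta.Term (X ⊕ (X →₀ W)) → Set (Sig.Term X →₀ W)
  finite : ∀ X ψ, (interp X ψ).Finite
  subst : ∀ {X Y : Type u} (σ : X → Y) (ψ : Theta.Term (X ⊕ (X →₀ W))),
    Finsupp.mapDomain (FirstOrder.Language.Term.relabel σ) '' interp X ψ =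
      interp Y (ψ.relabel (Sum.map σ (Finsupp.mapDomain σ)))

/-- WF-GSOS specifications: a set of rules and an interpretation, such that only finitely many
rules share the source operator, the label of the conclusion and the trigger
`⟨A₁, …, Aₙ⟩, ⟨w₁, …, wₚ⟩`. -/
structure Specification (W : Type w) [AddCommMonoid W] (A : Type v)
    (Sig : FirstOrder.Language.{u, u'}) (Theta : FirstOrder.Language.{t, t'}) where
  rules : {n : ℕ} → (f : Sig.Functions n) → Set (Rule W A Theta f)
  interpretation : Interpretation W Sig Theta
  finite : ∀ {n : ℕ} (f : Sig.Functions n) (c : A) (As : Fin n → Set A) (ws : List W),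
    {R ∈ rules f | R.label = c ∧ R.pos = As ∧ List.ofFn R.wt = ws}.Finite

/-- The ULTraS on ground process terms induced by a specification, by structural recursion:
`f(p₁, …, pₙ)` has exactly the `c`-labelled transitions obtained by interpreting the instances of
the targets of the rules with source operator `f` and label `c`. -/
noncomputable def Specification.induced {W : Type w} [AddCommMonoid W] {A : Type v}
    {Sig : FirstOrder.Language.{u, u'}} {Theta : FirstOrder.Language.{t, t'}}
    (S : Specification W A Sig Theta) : ULTraS W A (Ground Sig)
  | .var x => x.elim
  | .func f ps => fun c =>
      {ρ | ∃ R ∈ S.rules f, R.label = c ∧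
        ∃ ψ ∈ R.Instances ps (fun i => S.induced (ps i)),
          ρ ∈ Finsupp.mapDomain flatten '' S.interpretation.interp (Ground Sig) ψ}

end WFGSOS

/-! Bisimilarity is reduced to homomorphisms. The lifting along a kernel `f x = f y` is equality of
push-forwards along `f` (`liftRel_ker_iff`), so kernels of homomorphisms are bisimulations;
conversely bisimilarity is the kernel of its own quotient map, which is a homomorphism
(`isHom_quot_mk`). This gives both coincidence statements. For congruence, rules commute with
push-forward: total weights are preserved, and by the club axioms a selection premise holds for an
image exactly if it holds somewhere in the fibre. Hence the rules extend any ULTraS `α` to terms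
over its states, functorially in homomorphisms (`isHom_relabel`), and `flatten` is a homomorphism
from the extension of the induced ULTraS back to it (`isHom_flatten`). With bisimilar `p i`, `q i`
as variables, relabelling along the quotient map equates the two terms `f(…)`; they are thus
bisimilar, and `flatten` preserves this. -/

namespace WFGSOS

/-! ### Weights of sets -/

section Weight

variable {W : Type w} [AddCommMonoid W] {X : Type u} {Y : Type u'}

open Classical in
theorem weightOn_eq_sum (ρ : X →₀ W) (C : Set X) :
    weightOn ρ C = ρ.sum fun x r => if x ∈ C then r else 0 := by
  unfold weightOn totalWeight
  rw [Finsupp.sum, Finsupp.sum, Finsupp.support_filter, Finset.sum_filter]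
  refine Finset.sum_congr rfl fun x _ => ?_
  by_cases h : x ∈ C <;> simp [h]

theorem weightOn_mapDomain (f : X → Y) (ρ : X →₀ W) (D : Set Y) :
    weightOn (Finsupp.mapDomain f ρ) D = weightOn ρ (f ⁻¹' D) := by
  classical
  rw [weightOn_eq_sum, weightOn_eq_sum, Finsupp.sum_mapDomain_index]
  · rfl
  · intro y; simp
  · intro y r s; split_ifs <;> simp

theorem weightOn_singleton (ρ : X →₀ W) (x : X) : weightOn ρ {x} = ρ x := by
  classical
  rw [weightOn_eq_sum, Finsupp.sum]
  simp only [Set.mem_singleton_iff, Finset.sum_ite_eq', Finsupp.mem_support_iff]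
  split_ifs with h
  · rfl
  · exact (not_not.mp h).symm

theorem mapDomain_apply_eq_weightOn (f : X → Y) (ρ : X →₀ W) (y : Y) :
    Finsupp.mapDomain f ρ y = weightOn ρ (f ⁻¹' {y}) := by
  rw [← weightOn_mapDomain, weightOn_singleton]

theorem totalWeight_mapDomain (f : X → Y) (ρ : X →₀ W) :
    totalWeight (Finsupp.mapDomain f ρ) = totalWeight ρ :=
  Finsupp.sum_mapDomain_index (fun _ => rfl) fun _ _ _ => rfl

/-- A sum of weights outside a club stays outside, as the complement is a submonoid; one summand
inside puts the sum inside, as the club is an ideal. -/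
theorem IsClub.weightOn_mem_iff {K : Set W} (hK : IsClub K) (ρ : X →₀ W) (C : Set X) :
    weightOn ρ C ∈ K ↔ ∃ x ∈ C, ρ x ∈ K := by
  classical
  rw [weightOn_eq_sum, Finsupp.sum]
  constructor
  · intro h
    by_contra! hC
    refine Finset.sum_induction (fun x => if x ∈ C then ρ x else 0) (· ∈ Kᶜ)
      (fun a b ha hb => hK.add_compl a ha b hb) hK.zero_compl (fun x _ => ?_) h
    split_ifs with hx
    · exact hC x hx
    · exact hK.zero_compl
  · rintro ⟨x, hx, hρ⟩
    have hs : x ∈ ρ.support := by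
      rw [Finsupp.mem_support_iff]
      exact fun h0 => hK.zero_compl (h0 ▸ hρ)
    rw [← Finset.add_sum_erase _ _ hs, if_pos hx]
    exact hK.ideal _ hρ _

theorem IsClub.mapDomain_mem_iff {K : Set W} (hK : IsClub K) (f : X → Y) (ρ : X →₀ W) (y : Y) :
    Finsupp.mapDomain f ρ y ∈ K ↔ ∃ x, f x = y ∧ ρ x ∈ K := by
  rw [mapDomain_apply_eq_weightOn, hK.weightOn_mem_iff]
  rfl

end Weight

/-! ### Bisimulations and homomorphisms -/

section Bisimulation

variable {W : Type w} [AddCommMonoid W] {A : Type v}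

theorem LiftRel.mono {X : Type u} {Y : Type u'} {R R' : X → Y → Prop}
    (h : ∀ x y, R x y → R' x y) {φ : X →₀ W} {ψ : Y →₀ W} (hφ : LiftRel R φ ψ) :
    LiftRel R' φ ψ :=
  fun C D hCD => hφ C D
    ⟨fun x hx y hxy => hCD.1 x hx y (h x y hxy), fun y hy x hxy => hCD.2 y hy x (h x y hxy)⟩

/-- The subset-closed pairs of a kernel are the pairs `(C, C)` with `C` a union of fibres, and
weights of single fibres are the values of the push-forward. -/
theorem liftRel_ker_iff {X : Type u} {Y : Type u'} (f : X → Y) (φ ψ : X →₀ W) :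
    LiftRel (fun x y => f x = f y) φ ψ ↔ Finsupp.mapDomain f φ = Finsupp.mapDomain f ψ := by
  constructor
  · intro h
    ext y
    rw [mapDomain_apply_eq_weightOn, mapDomain_apply_eq_weightOn]
    exact h _ _ ⟨fun x hx z hxz => hxz.symm.trans hx, fun x hx z hxz => hxz.trans hx⟩
  · intro h C D hCD
    have hCD' : C = D := by
      ext x
      exact ⟨fun hx => hCD.1 x hx x rfl, fun hx => hCD.2 x hx x rfl⟩
    subst hCD'
    have hC : C = f ⁻¹' (f '' C) := by
      refine (Set.subset_preimage_image f C).antisymm ?_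
      rintro x ⟨y, hy, hyx⟩
      exact hCD.1 y hy x hyx
    rw [hC, ← weightOn_mapDomain, ← weightOn_mapDomain, h]

theorem isBisimulation_ker_iff {X : Type u} {Y : Type u'} (α : ULTraS W A X) (f : X → Y) :
    IsBisimulation α α (fun x y => f x = f y) ↔
      ∀ x y, f x = f y → ∀ a, Finsupp.mapDomain f '' α x a = Finsupp.mapDomain f '' α y a := by
  unfold IsBisimulation
  simp only [liftRel_ker_iff]
  refine forall₄_congr fun x y _ a => ?_
  rw [Set.Subset.antisymm_iff, Set.image_subset_iff, Set.image_subset_iff]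
  refine and_congr ?_ ?_
  · exact forall₂_congr fun φ _ => exists_congr fun ψ => and_congr_right fun _ => eq_comm
  · exact Iff.rfl

theorem IsHom.isBisimulation_ker {X : Type u} {Y : Type u'} {α : ULTraS W A X}
    {β : ULTraS W A Y} {f : X → Y} (hf : IsHom α β f) :
    IsBisimulation α α (fun x y => f x = f y) := by
  rw [isBisimulation_ker_iff]
  intro x y h a
  rw [← hf, ← hf, h]

/-- Homomorphisms map bisimulations to bisimulations. -/
theorem IsBisimulation.map {X : Type u} {Y : Type u'} {α : ULTraS W A X} {β : ULTraS W A Y}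
    {f : X → Y} (hf : IsHom α β f) {R : X → X → Prop} (hR : IsBisimulation α α R) :
    IsBisimulation β β (Relation.Map R f f) := by
  have key : ∀ φ ψ : X →₀ W, LiftRel R φ ψ →
      LiftRel (Relation.Map R f f) (Finsupp.mapDomain f φ) (Finsupp.mapDomain f ψ) := by
    intro φ ψ h C D hCD
    rw [weightOn_mapDomain, weightOn_mapDomain]
    exact h _ _ ⟨fun x hx y hxy => hCD.1 _ hx _ ⟨x, y, hxy, rfl, rfl⟩,
      fun y hy x hxy => hCD.2 _ hy _ ⟨x, y, hxy, rfl, rfl⟩⟩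
  rintro _ _ ⟨x, y, hxy, rfl, rfl⟩ a
  rw [hf, hf]
  constructor
  · rintro _ ⟨φ, hφ, rfl⟩
    obtain ⟨ψ, hψ, h⟩ := (hR x y hxy a).1 φ hφ
    exact ⟨_, ⟨ψ, hψ, rfl⟩, key φ ψ h⟩
  · rintro _ ⟨ψ, hψ, rfl⟩
    obtain ⟨φ, hφ, h⟩ := (hR x y hxy a).2 ψ hψ
    exact ⟨_, ⟨φ, hφ, rfl⟩, key φ ψ h⟩

variable {X : Type u} (α : ULTraS W A X)

theorem isBisimulation_bisimilar : IsBisimulation α α (Bisimilar α) := by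
  rintro x y ⟨R, hR, hxy⟩ a
  have hle : ∀ x y, R x y → Bisimilar α x y := fun x y h => ⟨R, hR, h⟩
  refine ⟨fun φ hφ => ?_, fun ψ hψ => ?_⟩
  · obtain ⟨ψ, hψ, h⟩ := (hR x y hxy a).1 φ hφ
    exact ⟨ψ, hψ, h.mono hle⟩
  · obtain ⟨φ, hφ, h⟩ := (hR x y hxy a).2 ψ hψ
    exact ⟨φ, hφ, h.mono hle⟩

/-- The kernel of the quotient by a bisimulation, i.e. the equivalence relation it generates, is
a bisimulation. -/
theorem IsBisimulation.quot {α : ULTraS W A X} {R : X → X → Prop} (hR : IsBisimulation α α R) :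
    IsBisimulation α α (fun x y => Quot.mk R x = Quot.mk R y) := by
  rw [isBisimulation_ker_iff]
  intro x y h a
  have hle : ∀ x y, R x y → Quot.mk R x = Quot.mk R y := fun _ _ => Quot.sound
  -- The set of pushed-forward transitions is invariant under `R`, so it descends to the quotient;
  -- no induction on chains of `R`-steps is needed.
  refine congrArg (Quot.lift (fun x => Finsupp.mapDomain (Quot.mk R) '' α x a) ?_) h
  intro x y hxy
  refine Set.Subset.antisymm ?_ ?_
  · rintro _ ⟨φ, hφ, rfl⟩
    obtain ⟨ψ, hψ, h⟩ := (hR x y hxy a).1 φ hφ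
    exact ⟨ψ, hψ, ((liftRel_ker_iff _ _ _).1 (h.mono hle)).symm⟩
  · rintro _ ⟨ψ, hψ, rfl⟩
    obtain ⟨φ, hφ, h⟩ := (hR x y hxy a).2 ψ hψ
    exact ⟨φ, hφ, (liftRel_ker_iff _ _ _).1 (h.mono hle)⟩

/-- Bisimilarity contains every bisimulation, in particular the equivalence it generates. -/
theorem quot_bisimilar_eq_iff {x y : X} :
    Quot.mk (Bisimilar α) x = Quot.mk (Bisimilar α) y ↔ Bisimilar α x y :=
  ⟨fun h => ⟨_, (isBisimulation_bisimilar α).quot, h⟩, Quot.sound⟩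

theorem bisimilar_equivalence : Equivalence (Bisimilar α) where
  refl _ := (quot_bisimilar_eq_iff α).1 rfl
  symm h := (quot_bisimilar_eq_iff α).1 (Quot.sound h).symm
  trans h h' := (quot_bisimilar_eq_iff α).1 ((Quot.sound h).trans (Quot.sound h'))

/-- The ULTraS on the quotient by bisimilarity. -/
noncomputable def quotientULTraS : ULTraS W A (Quot (Bisimilar α)) :=
  fun z a => Finsupp.mapDomain (Quot.mk _) '' α z.out a

/-- The representative chosen by `Quot.out` is immaterial: equivalent states have the same
pushed-forward transitions. -/
theorem isHom_quot_mk : IsHom α (quotientULTraS α) (Quot.mk (Bisimilar α)) := fun _ a =>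
  (isBisimulation_ker_iff α _).1 (isBisimulation_bisimilar α).quot _ _ (Quot.out_eq _) a

variable {α}

theorem Bisimilar.map {Y : Type u'} {β : ULTraS W A Y} {f : X → Y} (hf : IsHom α β f) {x y : X}
    (h : Bisimilar α x y) : Bisimilar β (f x) (f y) := by
  obtain ⟨R, hR, hxy⟩ := h
  exact ⟨_, hR.map hf, x, y, hxy, rfl, rfl⟩

theorem IsHom.bisimilar {Y : Type u'} {β : ULTraS W A Y} {f : X → Y} (hf : IsHom α β f) {x y : X}
    (h : f x = f y) : Bisimilar α x y :=
  ⟨_, hf.isBisimulation_ker, h⟩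

theorem behEquiv_iff_bisimilar {x y : X} : BehEquiv α x y ↔ Bisimilar α x y :=
  ⟨fun ⟨_, _, _, hf, h⟩ => hf.bisimilar h,
    fun h => ⟨_, quotientULTraS α, _, isHom_quot_mk α, Quot.sound h⟩⟩

theorem finBehEquiv_iff_bisimilar (hα : α.ImageFinite) {x y : X} :
    FinBehEquiv α x y ↔ Bisimilar α x y :=
  ⟨fun ⟨_, _, _, _, hf, h⟩ => hf.bisimilar h,
    fun h => ⟨_, quotientULTraS α, _, fun _ _ => (hα _ _).image _, isHom_quot_mk α,
      Quot.sound h⟩⟩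

end Bisimulation

/-! ### Naturality of rules -/

section Rules

open FirstOrder.Language (Term)

variable {W : Type w} [AddCommMonoid W] {A : Type v}
  {Sig : FirstOrder.Language.{u, u'}} {Theta : FirstOrder.Language.{t, t'}}

theorem Rule.instances_naturality {n : ℕ} {f : Sig.Functions n} (R : Rule W A Theta f)
    {X Y : Type u} (σ : X → Y) (x : Fin n → X) (h : Fin n → A → Set (X →₀ W)) :
    R.Instances (fun i => σ (x i)) (fun i a => Finsupp.mapDomain σ '' h i a) =
      Term.relabel (Sum.map σ (Finsupp.mapDomain σ)) '' R.Instances x h := by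
  have hrel : ∀ (θ : R.FunVar → (X →₀ W)) (y : Fin R.q → X),
      R.target.relabel (Sum.elim (fun i => Sum.inl (σ (x i)))
        (Sum.elim (fun k => Sum.inl (σ (y k)))
          (fun φ => Sum.inr (Finsupp.mapDomain σ (θ φ))))) =
      (R.target.relabel (Sum.elim (fun i => Sum.inl (x i))
        (Sum.elim (fun k => Sum.inl (y k)) (fun φ => Sum.inr (θ φ))))).relabel
          (Sum.map σ (Finsupp.mapDomain σ)) := by
    intro θ y
    rw [Term.relabel_relabel]
    congr 1
    funext z
    rcases z with i | k | φ <;> rfl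
  ext ψ
  constructor
  · rintro ⟨hpos, hneg, θ', y', hθ', hwt, hsel, rfl⟩
    -- Weight function variables are distinct, so preimages can be chosen independently. The `y k`
    -- are then chosen in the fibres of the `y' k`, which is where clubs are needed.
    choose θ hθ hθ'' using hθ'
    obtain rfl : (fun φ => Finsupp.mapDomain σ (θ φ)) = θ' := funext hθ''
    choose y hy hsel' using fun k => ((R.isClub k).mapDomain_mem_iff σ _ _).1 (hsel k)
    obtain rfl : (fun k => σ (y k)) = y' := funext hy
    refine ⟨_, ⟨fun i a ha => (hpos i a ha).of_image, fun i b hb => Set.image_eq_empty.1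
      (hneg i b hb), θ, y, hθ, fun k => ?_, hsel', rfl⟩, (hrel θ y).symm⟩
    rw [← hwt k, totalWeight_mapDomain]
  · rintro ⟨_, ⟨hpos, hneg, θ, y, hθ, hwt, hsel, rfl⟩, rfl⟩
    refine ⟨fun i a ha => (hpos i a ha).image _, fun i b hb => Set.image_eq_empty.2
      (hneg i b hb), fun φ => Finsupp.mapDomain σ (θ φ), fun k => σ (y k),
      fun φ => Set.mem_image_of_mem _ (hθ φ), fun k => ?_, fun k => ?_, (hrel θ y).symm⟩
    · rw [totalWeight_mapDomain, hwt]
    · exact ((R.isClub k).mapDomain_mem_iff σ _ _).2 ⟨_, rfl, hsel k⟩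

/-- The transitions derived for `f(x₁, …, xₙ)` from transitions of the `xᵢ`, when terms over `X`
are evaluated in `X` by `j`. -/
noncomputable def Specification.derive (S : Specification W A Sig Theta) {X : Type u}
    (j : Sig.Term X → X) {n : ℕ} (f : Sig.Functions n) (x : Fin n → X)
    (h : Fin n → A → Set (X →₀ W)) (c : A) : Set (X →₀ W) :=
  {ρ | ∃ R ∈ S.rules f, R.label = c ∧
    ∃ ψ ∈ R.Instances x h, ρ ∈ Finsupp.mapDomain j '' S.interpretation.interp X ψ}

theorem Specification.derive_naturality (S : Specification W A Sig Theta) {X Y : Type u}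
    {j : Sig.Term X → X} {j' : Sig.Term Y → Y} {σ : X → Y}
    (hσ : ∀ s, j' (s.relabel σ) = σ (j s)) {n : ℕ} (f : Sig.Functions n) (x : Fin n → X)
    (h : Fin n → A → Set (X →₀ W)) (c : A) :
    S.derive j' f (fun i => σ (x i)) (fun i a => Finsupp.mapDomain σ '' h i a) c =
      Finsupp.mapDomain σ '' S.derive j f x h c := by
  have hcomp : ∀ ρ : Sig.Term X →₀ W,
      Finsupp.mapDomain j' (Finsupp.mapDomain (Term.relabel σ) ρ) =
        Finsupp.mapDomain σ (Finsupp.mapDomain j ρ) := by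
    intro ρ
    rw [← Finsupp.mapDomain_comp, ← Finsupp.mapDomain_comp]
    exact congrArg (Finsupp.mapDomain · ρ) (funext hσ)
  ext ρ
  constructor
  · rintro ⟨R, hR, hc, ψ, hψ, hρ⟩
    rw [R.instances_naturality] at hψ
    obtain ⟨ψ, hψ, rfl⟩ := hψ
    rw [← S.interpretation.subst] at hρ
    obtain ⟨_, ⟨ρ, hρ, rfl⟩, rfl⟩ := hρ
    exact ⟨_, ⟨R, hR, hc, ψ, hψ, ρ, hρ, rfl⟩, (hcomp ρ).symm⟩
  · rintro ⟨_, ⟨R, hR, hc, ψ, hψ, ρ, hρ, rfl⟩, rfl⟩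
    refine ⟨R, hR, hc, ψ.relabel (Sum.map σ (Finsupp.mapDomain σ)), ?_, ?_⟩
    · rw [R.instances_naturality]
      exact Set.mem_image_of_mem _ hψ
    · rw [← S.interpretation.subst]
      exact ⟨_, Set.mem_image_of_mem _ hρ, hcomp ρ⟩

/-! ### The induced ULTraS -/

/-- The ULTraS on terms over the states of a given one. -/
noncomputable def Specification.onTerms (S : Specification W A Sig Theta) {X : Type u}
    (α : ULTraS W A X) : ULTraS W A (Sig.Term X)
  | .var x => fun c => Finsupp.mapDomain Term.var '' α x c
  | .func f ts => S.derive (fun s => s.subst id) f ts (fun i => Specification.onTerms S α (ts i))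

/-- Naturality of the term monad's multiplication; it makes `derive_naturality` applicable to
`Term.relabel σ`. -/
theorem subst_id_relabel {X Y : Type u} (σ : X → Y) (s : Sig.Term (Sig.Term X)) :
    (s.relabel (Term.relabel σ)).subst id = (s.subst id).relabel σ := by
  induction s with
  | var s => rfl
  | func f ts ih => exact congrArg (Term.func f) (funext ih)

/-- Associativity of `flatten` as an algebra of the term monad; it makes `derive_naturality`
applicable to `flatten`. -/
theorem flatten_relabel_flatten (s : Sig.Term (Sig.Term (Ground Sig))) :
    flatten (s.relabel flatten) = flatten (s.subst id) := by
  induction s with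
  | var s => rfl
  | func f ts ih => exact congrArg (Term.func f) (funext ih)

variable (S : Specification W A Sig Theta)

theorem Specification.induced_func {n : ℕ} (f : Sig.Functions n) (ps : Fin n → Ground Sig) :
    S.induced (.func f ps) = S.derive flatten f ps (fun i => S.induced (ps i)) := by
  funext c
  rw [Specification.induced]
  rfl

theorem Specification.isHom_relabel {X Y : Type u} {α : ULTraS W A X} {β : ULTraS W A Y}
    {σ : X → Y} (hσ : IsHom α β σ) :
    IsHom (S.onTerms α) (S.onTerms β) (Term.relabel σ) := by
  intro s
  induction s with
  | var x =>
    intro c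
    rw [Term.relabel, Specification.onTerms, Specification.onTerms]
    beta_reduce
    rw [hσ, ← Set.image_comp,
      ← Set.image_comp]
    refine Set.image_congr fun ρ _ => ?_
    simp only [Function.comp_apply, ← Finsupp.mapDomain_comp]
    rfl
  | func f ts ih =>
    intro c
    rw [Term.relabel, Specification.onTerms, Specification.onTerms,
      ← S.derive_naturality (j' := fun s => s.subst id) (subst_id_relabel σ)]
    congr 1
    exact funext fun i => funext (ih i)

theorem Specification.isHom_flatten : IsHom (S.onTerms S.induced) S.induced flatten := by
  intro s
  induction s with
  | var p =>
    intro c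
    rw [Specification.onTerms, ← Set.image_comp]
    have h : ∀ ρ : Ground Sig →₀ W,
        (Finsupp.mapDomain flatten ∘ Finsupp.mapDomain Term.var) ρ = ρ := fun ρ => by
      simp only [Function.comp_apply, ← Finsupp.mapDomain_comp]
      exact Finsupp.mapDomain_id
    rw [Set.image_congr fun ρ _ => h ρ, Set.image_id']
    rfl
  | func f ts ih =>
    intro c
    rw [Specification.onTerms, ← S.derive_naturality flatten_relabel_flatten]
    refine (congrFun (S.induced_func f fun i => flatten (ts i)) c).trans ?_
    congr 1
    exact funext fun i => funext (ih i)

theorem Specification.isCongruence_bisimilar : IsCongruence Sig (Bisimilar S.induced) where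
  equivalence := bisimilar_equivalence _
  func f p q h := by
    have hpq : Bisimilar (S.onTerms S.induced) (.func f fun i => .var (p i))
        (.func f fun i => .var (q i)) :=
      (S.isHom_relabel (isHom_quot_mk S.induced)).bisimilar
        -- Only variables change under the relabelling, so no algebra structure on the quotient is
        -- required.
        (congrArg (Term.func f) (funext fun i => congrArg Term.var (Quot.sound (h i))))
    exact hpq.map S.isHom_flatten

end Rules

end WFGSOS

theorem mainTheorem3 {W : Type w} [AddCommMonoid W] {A : Type v}
    {Sig : FirstOrder.Language.{u, u'}} {Theta : FirstOrder.Language.{t, t'}}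
    (S : WFGSOS.Specification W A Sig Theta) :
    WFGSOS.IsCongruence Sig (WFGSOS.Bisimilar S.induced) ∧
    (∀ p q : WFGSOS.Ground Sig,
      WFGSOS.BehEquiv S.induced p q ↔ WFGSOS.Bisimilar S.induced p q) ∧
    (WFGSOS.ULTraS.ImageFinite S.induced → ∀ p q : WFGSOS.Ground Sig,
      WFGSOS.FinBehEquiv S.induced p q ↔ WFGSOS.Bisimilar S.induced p q) :=
  ⟨S.isCongruence_bisimilar, fun _ _ => WFGSOS.behEquiv_iff_bisimilar,
    fun hS _ _ => WFGSOS.finBehEquiv_iff_bisimilar hS⟩
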